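/- Theorem. Let $X=(x_{rs})$ be an $m\times n$ matrix of positive real numbers. The $m\times n$ grid is the directed graph with vertex set $[m]\times[n]$ and edges $(r,s)\to(r+1,s)$ and $(r,s)\to(r,s+1)$. A path is a sequence of distinct vertices whose consecutive members are joined by edges (a single vertex is allowed). For integers $i,j,k$ with $0\le k\le\min(i,j)$ such that $(i+a,j+b)\in[m]\times[n]$ for some $a,b\in\{0,1\}$ (call such $(i,j,k)$ an index), let $$\bar y_{i,j,k}=\sum_{(\pi_1,\dots,\pi_k)}\ \prod_{l=1}^{k}\ \prod_{(r,s)\in\pi_l}x_{rs},$$ where the sum is over all $k$-tuples of pairwise vertex-disjoint paths in the grid, $\pi_l$ going from $(1,l)$ to $(i,j-k+l)$; the sum is read as $1$ if any of $i,j,k$ is $0$. Let $\mathrm{rect}(i,j)=\prod_{r\le i,\,s\le j}x_{rs}$ if $(i,j)\in[m]\times[n]$ and $\mathrm{rect}(i,j)=1$ otherwise, and let $\tilde y_{i,j,k}=\bar y_{i,j,k}/\mathrm{rect}(i,j)$. (a) The array $\tilde y$ satisfies the boundary conditions $$\tilde y_{i,j,0}=\frac1{\mathrm{rect}(i,j)},\qquad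 \tilde y_{i,j,\min(i,j)}=1$$ for all indices of these forms, and the bounded octahedron recurrence $$\tilde y_{i,j,k}\,\tilde y_{i-1,j-1,k-1}=\tilde y_{i-1,j,k}\,\tilde y_{i,j-1,k-1}+\tilde y_{i-1,j,k-1}\,\tilde y_{i,j-1,k}$$ for all indices $(i,j,k)$ with $1\le k\le\min(i,j)-1$. (b) The array $\tilde y$ can be computed in this way: every real array on the same indices that satisfies these boundary conditions and this recurrence is equal to $\tilde y$. (c) Hence birational RSK satisfies the bounded octahedron recurrence after normalization. That is, let $y_{i,j,0}=y_{i,j,\min(i,j)+1}=1$ and $y_{i,j,k}=\bar y_{i,j,k}/\bar y_{i,j,k-1}$ for $0<k\le\min(i,j)$ be the output array of birational RSK. Then the array $\frac{1}{\mathrm{rect}(i,j)}\prod_{l=1}^{k}y_{i,j,l}$ satisfies the same boundary conditions and the same recurrence. -/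

import Mathlib

/-- The vertex set `[m] × [n]` of the rectangular grid. -/
def gridVertices (m n : ℕ) : Finset (ℕ × ℕ) :=
  Finset.Icc 1 m ×ˢ Finset.Icc 1 n

/-- The directed edges of the grid, in matrix coordinates: one step down or one step right. -/
def GridEdge (u v : ℕ × ℕ) : Prop :=
  v = (u.1 + 1, u.2) ∨ v = (u.1, u.2 + 1)

/-- `p` is a path of the `m × n` grid connecting `u` to `v`: a sequence of distinct grid vertices,
starting at `u` and ending at `v`, whose consecutive members are joined by edges. -/
def IsGridPath (m n : ℕ) (u v : ℕ × ℕ) (p : List (ℕ × ℕ)) : Prop :=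
  p.head? = some u ∧ p.getLast? = some v ∧ p.Nodup ∧
    (∀ a ∈ p, a ∈ gridVertices m n) ∧ p.IsChain GridEdge

/-- The `k`-tuples of pairwise vertex-disjoint grid paths, the path with index `s` connecting
`S s` to `T s`. -/
def NCPath (m n k : ℕ) (S T : Fin k → ℕ × ℕ) : Set (Fin k → List (ℕ × ℕ)) :=
  {P | (∀ s, IsGridPath m n (S s) (T s) (P s)) ∧ ∀ s t, s ≠ t → List.Disjoint (P s) (P t)}

theorem finite_NCPath (m n k : ℕ) (S T : Fin k → ℕ × ℕ) : (NCPath m n k S T).Finite := by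
  have h : {l : List (ℕ × ℕ) | l.Nodup ∧ ∀ a ∈ l, a ∈ gridVertices m n}.Finite := by
    refine (Set.finite_range
      (fun l : {l : List (gridVertices m n) // l.Nodup} => l.1.map Subtype.val)).subset ?_
    rintro l ⟨hn, hl⟩
    refine ⟨⟨l.attach.map (fun a => ⟨a.1, hl a.1 a.2⟩), ?_⟩, ?_⟩
    · refine (List.nodup_attach.2 hn).map ?_
      intro a b hab
      exact Subtype.ext (congrArg (fun c : gridVertices m n => c.1) hab)
    · change List.map Subtype.val (List.map _ l.attach) = l
      rw [List.map_map]
      exact List.attach_map_subtype_val l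
  refine (Set.Finite.pi' (fun _ : Fin k => h)).subset ?_
  intro P hP s
  exact ⟨(hP.1 s).2.2.1, (hP.1 s).2.2.2.1⟩

/-- Noncrossing `k`-tuples of paths from `(1,1), …, (1,k)` to `(i,j-k+1), …, (i,j)`
(used for `k ≤ j`; the index `s : Fin k` runs from `0` to `k - 1`). -/
def RSKPath (m n i j k : ℕ) : Set (Fin k → List (ℕ × ℕ)) :=
  NCPath m n k (fun s => (1, s + 1)) (fun s => (i, j - k + (s + 1)))

/-- The weight of a tuple of paths: the product of the entries of `x` at all their vertices. -/
noncomputable def tupleWeight {k : ℕ} (x : ℕ → ℕ → ℝ) (P : Fin k → List (ℕ × ℕ)) : ℝ :=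
  ∏ s, ((P s).map (fun v => x v.1 v.2)).prod

open Classical in
/-- The array of weighted sums over noncrossing tuples of paths; an empty sum is treated as `1`. -/
noncomputable def ybar (m n : ℕ) (x : ℕ → ℕ → ℝ) (i j k : ℕ) : ℝ :=
  if RSKPath m n i j k = ∅ then 1
  else ∑ P ∈ (finite_NCPath m n k (fun s => (1, s + 1))
    (fun s => (i, j - k + (s + 1)))).toFinset, tupleWeight x P

/-- The rectangular product at `(i, j)`, equal to `1` if `(i, j)` is not in the grid. -/
noncomputable def rect (m n : ℕ) (x : ℕ → ℕ → ℝ) (i j : ℕ) : ℝ :=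
  if (i, j) ∈ gridVertices m n then ∏ r ∈ Finset.Icc 1 i, ∏ s ∈ Finset.Icc 1 j, x r s else 1

/-- The normalized array. -/
noncomputable def ytilde (m n : ℕ) (x : ℕ → ℕ → ℝ) (i j k : ℕ) : ℝ :=
  ybar m n x i j k / rect m n x i j

/-- The index set of the arrays `ybar` and `ytilde`. -/
def IsIndex (m n i j k : ℕ) : Prop :=
  k ≤ min i j ∧ ∃ a ≤ 1, ∃ b ≤ 1, (i + a, j + b) ∈ gridVertices m n

/-- `w` satisfies the bounded octahedron recurrence on the index set, with the boundary values
`1 / rect` at `k = 0` and `1` at `k = min i j`. No subtraction below is truncated. -/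
def BoundedOctahedron (m n : ℕ) (x : ℕ → ℕ → ℝ) (w : ℕ → ℕ → ℕ → ℝ) : Prop :=
  (∀ i j, IsIndex m n i j 0 → w i j 0 = 1 / rect m n x i j) ∧
  (∀ i j, IsIndex m n i j (min i j) → w i j (min i j) = 1) ∧
  (∀ i j k, IsIndex m n i j k → 1 ≤ k → k ≤ min i j - 1 →
    w i j k * w (i - 1) (j - 1) (k - 1) =
      w (i - 1) j k * w i (j - 1) (k - 1) + w (i - 1) j (k - 1) * w i (j - 1) k)

/-- The array produced by birational RSK: quotients of successive entries of `ybar`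
for `0 < k ≤ min i j`, and `1` at `k = 0` and at `k = min i j + 1`. (Entries with a coordinate
`i` or `j` equal to `-1` are constantly `1` by the `k = 0` rule and are not represented.) -/
noncomputable def birationalRSK (m n : ℕ) (x : ℕ → ℕ → ℝ) (i j k : ℕ) : ℝ :=
  if k = 0 ∨ k = min i j + 1 then 1 else ybar m n x i j k / ybar m n x i j (k - 1)

/-! By the Lindström–Gessel–Viennot principle, `ybar` at `(i, j, k)` is a minor of the path matrix:
the first `k` sources against the sinks in row `i`, columns `j - k + 1` to `j`. The path matrix at
row `i + 1` arises from row `i` by adding a multiple of the preceding column to each column and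
scaling. Hence all the minors in the recurrence can be written with columns of row `i` and a single
column of row `i + 1`, where the three-term Plücker relation becomes the recurrence up to the factor
`x` at the new corner (`pathMinor_octahedron`). Dividing by rectangular products absorbs this factor
(`rectProd_succ_succ`).

At `k = j` the minor is triangular (`pathMinor_one`). At `k = i` one term of the octahedron relation
vanishes, and induction gives the rectangular product again (`pathMinor_self`). The relation also
makes the minors positive, so the recurrence can be solved for its top entry, which gives
uniqueness. The RSK products telescope to `ybar`.

The determinant formula (`finsum_extTuples_eq_det`) needs no sign-reversing involution: both sides
obey the same recursion when the last vertex of one path is removed. -/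

/-! ### Column minors and the three-term Plücker relation. -/

/-- The leading `k × k` minor of the matrix whose column with index `l` is `c l`. -/
noncomputable def colMinor (k : ℕ) (c : ℕ → ℕ → ℝ) : ℝ :=
  (Matrix.of fun a l : Fin k => c l a).det

theorem colMinor_congr {k : ℕ} {c d : ℕ → ℕ → ℝ} (h : ∀ l < k, ∀ a < k, c l a = d l a) :
    colMinor k c = colMinor k d := by
  unfold colMinor
  congr 1
  ext a l
  exact h l l.2 a a.2

theorem colMinor_zero (c : ℕ → ℕ → ℝ) : colMinor 0 c = 1 := by
  simp [colMinor]

theorem colMinor_eq_zero_of_eq {k : ℕ} {c : ℕ → ℕ → ℝ} {l l' : ℕ} (hl : l < k) (hl' : l' < k)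
    (hne : l ≠ l') (h : ∀ a < k, c l a = c l' a) : colMinor k c = 0 :=
  Matrix.det_zero_of_column_eq (i := ⟨l, hl⟩) (j := ⟨l', hl'⟩) (by simpa using hne)
    fun a => h a a.2

/-- Moving the last column of a minor to the front. -/
theorem colMinor_rotate (r : ℕ) (c : ℕ → ℕ → ℝ) :
    colMinor (r + 1) (fun l => if l = 0 then c r else c (l - 1)) =
      (-1) ^ r * colMinor (r + 1) c := by
  have h := Matrix.det_permute' (finRotate (r + 1)) (Matrix.of fun a l : Fin (r + 1) =>
    (if (l : ℕ) = 0 then c r else c (l - 1)) (a : ℕ))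
  rw [sign_finRotate] at h
  have h2 : ((Matrix.of fun a l : Fin (r + 1) =>
      (if (l : ℕ) = 0 then c r else c (l - 1)) (a : ℕ)).submatrix id (finRotate (r + 1))).det =
      colMinor (r + 1) c := by
    unfold colMinor
    congr 1
    ext a l
    simp only [Matrix.submatrix_apply, Matrix.of_apply, id]
    rw [coe_finRotate]
    by_cases hl : l = Fin.last r
    · simp [hl]
    · simp [hl]
  rw [h2] at h
  rw [h]
  push_cast
  rw [← mul_assoc, ← mul_pow]
  simp [colMinor]

/-- Laplace expansion along the first column; the cofactors do not involve that column. -/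
theorem exists_coeff_colMinor_head (r : ℕ) (c : ℕ → ℕ → ℝ) :
    ∃ v : Fin (r + 1) → ℝ, ∀ z : ℕ → ℝ,
      colMinor (r + 1) (fun l => if l = 0 then z else c l) = ∑ a, v a * z a := by
  refine ⟨fun a => (-1) ^ (a : ℕ) * ((Matrix.of fun a l : Fin (r + 1) => c l a).submatrix
    a.succAbove Fin.succ).det, fun z => ?_⟩
  unfold colMinor
  rw [Matrix.det_succ_column_zero]
  refine Finset.sum_congr rfl fun a _ => ?_
  have : ((Matrix.of fun a l : Fin (r + 1) => (if (l : ℕ) = 0 then z else c l) (a : ℕ)).submatrix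
      a.succAbove Fin.succ) = ((Matrix.of fun a l : Fin (r + 1) => c l a).submatrix
      a.succAbove Fin.succ) := by
    ext b l
    simp
  rw [this]
  simp
  ring

/-- The three-term Plücker relation between the minors of a matrix with `r + 3` columns. -/
theorem colMinor_pluecker (r : ℕ) (y : ℕ → ℕ → ℝ) :
    colMinor (r + 2) (fun l => if l = 0 then y 0 else y (l + 1)) *
        colMinor (r + 1) (fun l => y (l + 1)) =
      colMinor (r + 2) (fun l => y (l + 1)) *
        colMinor (r + 1) (fun l => if l = 0 then y 0 else y (l + 1)) +
      colMinor (r + 1) (fun l => y (l + 2)) * colMinor (r + 2) y := by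
  obtain ⟨v, hv⟩ := exists_coeff_colMinor_head r (fun l => y (l + 1))
  set φ : (ℕ → ℝ) → ℝ := fun z =>
    colMinor (r + 1) (fun l => if l = 0 then z else y (l + 1)) with hφ
  have hφ1 : φ (y 1) = colMinor (r + 1) (fun l => y (l + 1)) :=
    colMinor_congr fun l _ a _ => by
      by_cases h : l = 0 <;> simp [h]
  have hφU : ∀ i < r, φ (y (i + 2)) = 0 := fun i hi =>
    colMinor_eq_zero_of_eq (l := 0) (l' := i + 1) (by omega) (by omega) (by omega) (by simp)
  have hφ2 : φ (y (r + 2)) = (-1) ^ r * colMinor (r + 1) (fun l => y (l + 2)) := by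
    rw [← colMinor_rotate]
    refine colMinor_congr fun l _ a _ => ?_
    rcases l with _ | l <;> simp
  -- The last row applies `φ` to the columns, so it is a combination of the first `r + 1` rows and
  -- `N` is singular. Expansion along it leaves only columns `0`, `1` and `r + 2`, because `φ` kills
  -- the columns it already contains.
  set N : Matrix (Fin (r + 3)) (Fin (r + 3)) ℝ := Matrix.of fun a l =>
    if (a : ℕ) = r + 2 then φ (y l) else y l a with hN
  have hdet : N.det = 0 := by
    refine Matrix.exists_vecMul_eq_zero_iff.1
      -- Row `r + 1` gets coefficient `0`: the minor `φ` has height only `r + 1`.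
      ⟨fun a => if h : (a : ℕ) < r + 1 then v ⟨a, h⟩ else if (a : ℕ) = r + 2 then -1 else 0,
        fun h => ?_, ?_⟩
    · have := congrFun h (Fin.last _)
      simp at this
    · ext l
      rw [Matrix.vecMul, dotProduct, Fin.sum_univ_castSucc, Fin.sum_univ_castSucc]
      have : φ (y l) = ∑ a, v a * y l a := hv (y l)
      simp [hN, this]
      rw [← sub_eq_add_neg, sub_eq_zero]
      refine Finset.sum_congr rfl fun a _ => ?_
      have := a.2
      rw [if_neg (by omega), if_pos (by omega)]
  rw [Matrix.det_succ_row N (Fin.last _), Fin.sum_univ_succ, Fin.sum_univ_succ,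
    Fin.sum_univ_castSucc, Finset.sum_eq_zero] at hdet
  · have s0 : (N.submatrix (Fin.last (r + 2)).succAbove (0 : Fin (r + 3)).succAbove).det =
        colMinor (r + 2) (fun l => y (l + 1)) := by
      unfold colMinor
      congr 1
      ext a l
      have := a.2
      simp [hN]
      omega
    have s1 : (N.submatrix (Fin.last (r + 2)).succAbove
        (Fin.succ (0 : Fin (r + 2))).succAbove).det =
        colMinor (r + 2) (fun l => if l = 0 then y 0 else y (l + 1)) := by
      unfold colMinor
      congr 1
      ext a l
      have := a.2
      induction l using Fin.cases with
      | zero => simp [hN]; omega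
      | succ l => simp [hN]; omega
    have s2 : (N.submatrix (Fin.last (r + 2)).succAbove (Fin.last (r + 2)).succAbove).det =
        colMinor (r + 2) y := by
      unfold colMinor
      congr 1
      ext a l
      have := a.2
      simp [hN]
      omega
    have e : (Fin.last r).succ.succ = Fin.last (r + 2) := rfl
    rw [e, s0, s1, s2] at hdet
    have n0 : N (Fin.last (r + 2)) 0 = φ (y 0) := by simp [hN]
    have n1 : N (Fin.last (r + 2)) (Fin.succ (0 : Fin (r + 2))) = φ (y 1) := by simp [hN]
    have n2 : N (Fin.last (r + 2)) (Fin.last (r + 2)) = φ (y (r + 2)) := by simp [hN]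
    rw [n0, n1, n2, hφ1, hφ2] at hdet
    have hs : ((-1 : ℝ) ^ r) * (-1) ^ r = 1 := by rw [← mul_pow]; simp
    simp only [Fin.val_last, Fin.val_zero, Fin.val_succ, pow_add, zero_add, add_zero, pow_one] at hdet
    change _ = _ * φ (y 0) + _
    have hs' : ((-1 : ℝ) ^ r) ≠ 0 := by positivity
    apply mul_left_cancel₀ hs'
    linear_combination -hdet + ((-1 : ℝ) ^ r) * colMinor (r + 1) (fun l => y (l + 2)) *
      colMinor (r + 2) y * hs
  · intro i _
    have : N (Fin.last (r + 2)) i.castSucc.succ.succ = 0 := by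
      simp [hN]
      exact hφU i i.2
    rw [this]
    ring

/-- Column operations for columns obeying the recursion `w_{l+1} = x_{l+1} (w_l + u_{l+1})`. -/
theorem colMinor_eq_prod_mul (k : ℕ) (t : ℕ → ℝ) (w u : ℕ → ℕ → ℝ)
    (h : ∀ l a, w (l + 1) a = t (l + 1) * (w l a + u (l + 1) a)) :
    colMinor (k + 1) w =
      (∏ l ∈ Finset.range k, t (l + 1)) *
        colMinor (k + 1) (fun l => if l = 0 then w 0 else u l) := by
  have h1 : colMinor (k + 1) w =
      (Matrix.of fun a l : Fin (k + 1) => (if l = 0 then 1 else t l) *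
        (Matrix.of fun a l : Fin (k + 1) => (if (l : ℕ) = 0 then w 0 else u l) (a : ℕ)) a l).det := by
    refine Matrix.det_eq_of_forall_col_eq_smul_add_pred (fun l => t (l + 1)) ?_ ?_
    · intro i; simp
    · intro i j
      simp [h]
      ring
  rw [h1, Matrix.det_mul_row, Fin.prod_univ_succ]
  simp [colMinor, Finset.prod_range]

/-! ### The path matrix and the octahedron relation for its minors. -/

/-- The sum of the weights of the paths from `(1, a + 1)` to `(i, b)`, defined by recursion over
the last step; the row `i = 0` is that of an identity matrix. -/
def pathSum (x : ℕ → ℕ → ℝ) (a : ℕ) : ℕ → ℕ → ℝ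
  | 0, b => if b = a + 1 then 1 else 0
  | _ + 1, 0 => 0
  | i + 1, b + 1 => x (i + 1) (b + 1) * (pathSum x a (i + 1) b + pathSum x a i (b + 1))

/-- The minor of the path matrix on the first `k` sources and on the `k` sinks
`(i, p), …, (i, p + k - 1)`. -/
noncomputable def pathMinor (x : ℕ → ℕ → ℝ) (i p k : ℕ) : ℝ :=
  colMinor k fun l a => pathSum x a i (p + l)

theorem colMinor_head_linear (r : ℕ) (c : ℕ → ℕ → ℝ) (t : ℝ) (z z' : ℕ → ℝ) :
    colMinor (r + 1) (fun l => if l = 0 then fun a => t * (z a + z' a) else c l) =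
      t * (colMinor (r + 1) (fun l => if l = 0 then z else c l) +
        colMinor (r + 1) (fun l => if l = 0 then z' else c l)) := by
  obtain ⟨v, hv⟩ := exists_coeff_colMinor_head r c
  rw [hv, hv, hv, ← Finset.sum_add_distrib, Finset.mul_sum]
  exact Finset.sum_congr rfl fun a _ => by ring

/-- Column operations turn every column but the first into one of row `i`; the first is then split
by its own recursion. This isolates the mixed minor that enters the Plücker relation. -/
theorem pathMinor_succ_row (x : ℕ → ℕ → ℝ) (i q r : ℕ) :
    pathMinor x (i + 1) (q + 1) (r + 1) =
      (∏ l ∈ Finset.range r, x (i + 1) (q + l + 2)) * (x (i + 1) (q + 1) *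
        (colMinor (r + 1) (fun l => if l = 0 then fun a => pathSum x a (i + 1) q
            else fun a => pathSum x a i (q + 1 + l)) +
          pathMinor x i (q + 1) (r + 1))) := by
  have h := colMinor_eq_prod_mul r (fun l => x (i + 1) (q + 1 + l))
    (fun l a => pathSum x a (i + 1) (q + 1 + l)) (fun l a => pathSum x a i (q + 1 + l))
    (fun l a => by rw [show q + 1 + (l + 1) = (q + l + 1) + 1 by ring, pathSum]; ring_nf)
  unfold pathMinor
  rw [h]
  congr 1
  · exact Finset.prod_congr rfl fun l _ => by ring_nf
  · have h2 := colMinor_head_linear r (fun l a => pathSum x a i (q + 1 + l)) (x (i + 1) (q + 1))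
      (fun a => pathSum x a (i + 1) q) (fun a => pathSum x a i (q + 1))
    have e : (fun l => if l = 0 then fun a => pathSum x a i (q + 1)
        else fun a => pathSum x a i (q + 1 + l)) = fun l a => pathSum x a i (q + 1 + l) := by
      ext l a
      by_cases hl : l = 0 <;> simp [hl]
    rw [e] at h2
    rw [← h2]
    simp only [add_zero, pathSum]

/-- The unnormalized octahedron recurrence for the minors of the path matrix. -/
theorem pathMinor_octahedron (x : ℕ → ℕ → ℝ) (i q k : ℕ) :
    pathMinor x (i + 1) (q + 1) (k + 1) * pathMinor x i (q + 1) k =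
      x (i + 1) (q + 1 + k) *
        (pathMinor x i (q + 1) (k + 1) * pathMinor x (i + 1) (q + 1) k +
          pathMinor x i (q + 2) k * pathMinor x (i + 1) q (k + 1)) := by
  rcases k with _ | r
  · simp [pathMinor, colMinor, pathSum]
    left
    ring
  -- Column `0` comes from row `i + 1` at position `q`, the others from row `i` at positions `q + 1`
  -- to `q + r + 2`.
  · have hP := colMinor_pluecker r (fun l => if l = 0 then fun a => pathSum x a (i + 1) q
      else fun a => pathSum x a i (q + l))
    have hG := colMinor_eq_prod_mul (r + 1) (fun l => x (i + 1) (q + l))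
      (fun l a => pathSum x a (i + 1) (q + l)) (fun l a => pathSum x a i (q + l))
      (fun l a => by rw [show q + (l + 1) = (q + l) + 1 by ring, pathSum])
    rw [Finset.prod_range_succ'] at hG
    rw [pathMinor_succ_row, pathMinor_succ_row x i q r, Finset.prod_range_succ]
    change pathMinor x (i + 1) q (r + 1 + 1) = _ at hG
    rw [hG]
    simp only [Nat.add_eq_zero_iff, one_ne_zero, and_false, if_false, if_true,
      OfNat.ofNat_ne_zero] at hP
    have e1 : ∀ n, (colMinor n fun l a => pathSum x a i (q + (l + 1))) = pathMinor x i (q + 1) n :=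
      fun n => by unfold pathMinor; congr 1; ext l a; congr 1; ring
    have e2 : ∀ n, (colMinor n fun l a => pathSum x a i (q + (l + 2))) = pathMinor x i (q + 2) n :=
      fun n => by unfold pathMinor; congr 1; ext l a; congr 1; ring
    have e3 : ∀ n, (colMinor n fun l => if l = 0 then fun a => pathSum x a (i + 1) q
        else fun a => pathSum x a i (q + (l + 1))) = colMinor n fun l =>
          if l = 0 then fun a => pathSum x a (i + 1) q else fun a => pathSum x a i (q + 1 + l) :=
      fun n => by
        congr 1; ext l a
        rw [show q + (l + 1) = q + 1 + l by ring]
    rw [e1, e1, e2, e3, e3] at hP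
    have e4 : ∏ l ∈ Finset.range r, x (i + 1) (q + (l + 1 + 1)) =
        ∏ l ∈ Finset.range r, x (i + 1) (q + l + 2) :=
      Finset.prod_congr rfl fun l _ => by ring_nf
    rw [e4, show q + (0 + 1) = q + 1 by ring, show q + 1 + (r + 1) = q + r + 2 by ring]
    simp only [add_zero]
    linear_combination (∏ l ∈ Finset.range r, x (i + 1) (q + l + 2)) * x (i + 1) (q + r + 2) *
      x (i + 1) (q + 1) * hP

/-! ### Boundary values and positivity of the minors. -/

/-- The product of all entries in the leading `i × j` rectangle. -/
def rectProd (x : ℕ → ℕ → ℝ) (i j : ℕ) : ℝ :=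
  ∏ r ∈ Finset.Icc 1 i, ∏ s ∈ Finset.Icc 1 j, x r s

theorem rectProd_succ_succ (x : ℕ → ℕ → ℝ) (i j : ℕ) :
    rectProd x (i + 1) (j + 1) * rectProd x i j =
      x (i + 1) (j + 1) * (rectProd x i (j + 1) * rectProd x (i + 1) j) := by
  unfold rectProd
  rw [Finset.prod_Icc_succ_top (by omega), Finset.prod_Icc_succ_top (a := 1) (b := i) (by omega),
    Finset.prod_Icc_succ_top (a := 1) (b := j) (by omega)]
  ring

theorem pathSum_eq_zero (x : ℕ → ℕ → ℝ) (a i b : ℕ) (h : b < a + 1) : pathSum x a i b = 0 := by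
  induction i generalizing b with
  | zero => simp [pathSum]; omega
  | succ i ih =>
    induction b with
    | zero => simp [pathSum]
    | succ b ihb => rw [pathSum, ihb (by omega), ih _ h]; simp

theorem pathSum_diag (x : ℕ → ℕ → ℝ) (a i : ℕ) :
    pathSum x a i (a + 1) = ∏ r ∈ Finset.Icc 1 i, x r (a + 1) := by
  induction i with
  | zero => simp [pathSum]
  | succ i ih =>
    rw [pathSum, pathSum_eq_zero x a (i + 1) a (by omega), ih,
      Finset.prod_Icc_succ_top (by omega)]
    ring

theorem pathMinor_one (x : ℕ → ℕ → ℝ) (i k : ℕ) : pathMinor x i 1 k = rectProd x i k := by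
  unfold pathMinor colMinor rectProd
  rw [Matrix.det_of_isUpperTriangular, Finset.prod_comm]
  · simp only [Matrix.of_apply]
    rw [← Finset.prod_range (fun l => pathSum x l i (1 + l)), Finset.range_eq_Ico,
      ← Finset.Ico_succ_right_eq_Icc, Nat.succ_eq_succ, Nat.succ_eq_add_one,
      ← Finset.prod_Ico_add' _ 0 k 1]
    exact Finset.prod_congr rfl fun l _ => by rw [add_comm 1 l, pathSum_diag]
  · intro a l h
    exact pathSum_eq_zero _ _ _ _ (by simp only [id, Fin.lt_def] at h; omega)

/-- In row `0` a column beyond `k` is zero. Each new row enlarges the required window by one: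
inverting the recursion, which needs `x` nonzero, expresses a column of row `i` by two adjacent
columns of row `i + 1`. -/
theorem pathSum_mem_span {x : ℕ → ℕ → ℝ} (hx : ∀ r s, 0 < x r s) (k i b : ℕ) (hb : k < b) :
    (fun a : Fin k => pathSum x a i b) ∈
      Submodule.span ℝ ((fun b => fun a : Fin k => pathSum x a i b) '' Set.Ico (b - i) b) := by
  induction i generalizing b with
  | zero =>
    have : (fun a : Fin k => pathSum x a 0 b) = 0 := by
      ext a
      simp [pathSum]
      omega
    rw [this]
    exact zero_mem _
  | succ i ih =>
    obtain ⟨b, rfl⟩ : ∃ c, b = c + 1 := ⟨b - 1, by omega⟩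
    set V := Submodule.span ℝ ((fun b => fun a : Fin k => pathSum x a (i + 1) b) ''
      Set.Ico (b + 1 - (i + 1)) (b + 1)) with hV
    have hmem : ∀ c, b + 1 - (i + 1) ≤ c → c < b + 1 →
        (fun a : Fin k => pathSum x a (i + 1) c) ∈ V := fun c h1 h2 =>
      Submodule.subset_span ⟨c, ⟨h1, h2⟩, rfl⟩
    have hle : Submodule.span ℝ ((fun b => fun a : Fin k => pathSum x a i b) ''
        Set.Ico (b + 1 - i) (b + 1)) ≤ V := by
      rw [Submodule.span_le]
      rintro _ ⟨c, ⟨h1, h2⟩, rfl⟩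
      rcases c with _ | c
      · have : (fun a : Fin k => pathSum x a i 0) = 0 := by
          ext a; exact pathSum_eq_zero _ _ _ _ (by omega)
        simp only [this]
        exact zero_mem _
      · have : (fun a : Fin k => pathSum x a i (c + 1)) =
            (x (i + 1) (c + 1))⁻¹ • (fun a : Fin k => pathSum x a (i + 1) (c + 1)) -
              fun a : Fin k => pathSum x a (i + 1) c := by
          ext a
          have := (hx (i + 1) (c + 1)).ne'
          simp [pathSum]
          field_simp
          ring
        simp only [this]
        exact V.sub_mem (V.smul_mem _ (hmem _ (by omega) (by omega)))
          (hmem _ (by omega) (by omega))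
    have : (fun a : Fin k => pathSum x a (i + 1) (b + 1)) = x (i + 1) (b + 1) •
        ((fun a : Fin k => pathSum x a (i + 1) b) + fun a : Fin k => pathSum x a i (b + 1)) := by
      ext a
      simp [pathSum]
    rw [this]
    exact V.smul_mem _ (V.add_mem (hmem _ (by omega) (by omega)) (hle (ih _ hb)))

/-- The last column lies beyond `k`, hence in the span of the `i` columns before it, all of which
belong to the minor since `i < k`. -/
theorem pathMinor_eq_zero {x : ℕ → ℕ → ℝ} (hx : ∀ r s, 0 < x r s) {i k : ℕ} (h : i < k) (q : ℕ) :
    pathMinor x i (q + 2) k = 0 := by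
  obtain ⟨k, rfl⟩ : ∃ c, k = c + 1 := ⟨k - 1, by omega⟩
  refine Matrix.det_eq_zero_of_not_linearIndependent_cols fun hli => ?_
  refine hli.notMem_span_image (s := Set.univ \ {Fin.last k}) (x := Fin.last k) (by simp) ?_
  refine Submodule.span_mono ?_ (pathSum_mem_span hx (k + 1) i (q + 2 + k) (by omega))
  rintro _ ⟨c, ⟨h1, h2⟩, rfl⟩
  refine ⟨⟨c - (q + 2), by omega⟩, ?_, ?_⟩
  · simp [Fin.ext_iff]
    omega
  · ext a
    simp
    congr 1
    omega

theorem rectProd_pos {x : ℕ → ℕ → ℝ} (hx : ∀ r s, 0 < x r s) (i j : ℕ) : 0 < rectProd x i j :=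
  Finset.prod_pos fun _ _ => Finset.prod_pos fun _ _ => hx _ _

theorem pathMinor_self {x : ℕ → ℕ → ℝ} (hx : ∀ r s, 0 < x r s) (i q : ℕ) :
    pathMinor x i (q + 1) i = rectProd x i (q + i) := by
  induction i generalizing q with
  | zero => simp [pathMinor, colMinor_zero, rectProd]
  | succ i ih =>
    induction q with
    | zero => simpa using pathMinor_one x (i + 1) (i + 1)
    | succ q ihq =>
      have h := pathMinor_octahedron x i (q + 1) i
      rw [pathMinor_eq_zero hx (Nat.lt_succ_self i), ih, ih (q + 1 + 1), ihq] at h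
      have h2 := rectProd_succ_succ x i (q + 1 + i)
      apply mul_right_cancel₀ (rectProd_pos hx i (q + 1 + i)).ne'
      rw [h, show q + 1 + (i + 1) = q + 1 + i + 1 by ring, h2]
      ring_nf

/-- The octahedron relation is subtraction-free, so positivity propagates from the boundary. The
case `k = i` is separate, since there one of the products vanishes. -/
theorem pathMinor_pos {x : ℕ → ℕ → ℝ} (hx : ∀ r s, 0 < x r s) {i k : ℕ} (h : k ≤ i) (q : ℕ) :
    0 < pathMinor x i (q + 1) k := by
  induction i generalizing k q with
  | zero =>
    obtain rfl : k = 0 := by omega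
    simp [pathMinor, colMinor_zero]
  | succ i ih =>
    induction k generalizing q with
    | zero => simp [pathMinor, colMinor_zero]
    | succ k ihk =>
      rcases Nat.lt_or_ge k i with hk | hk
      · induction q with
        | zero =>
          rw [zero_add, pathMinor_one]
          exact rectProd_pos hx _ _
        | succ q ihq =>
          have h3 := pathMinor_octahedron x i (q + 1) k
          have hp : 0 < pathMinor x i (q + 1 + 1) k := ih (by omega) _
          refine pos_of_mul_pos_left ?_ hp.le
          rw [h3]
          exact mul_pos (hx _ _) (add_pos (mul_pos (ih (by omega) _) (ihk (by omega) _))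
            (mul_pos (ih (by omega) (q + 2)) ihq))
      · obtain rfl : k = i := by omega
        rw [pathMinor_self hx]
        exact rectProd_pos hx _ _

/-! ### Grid paths and removal of the last vertex. -/

theorem GridEdge.lt {u v : ℕ × ℕ} (h : GridEdge u v) : u < v := by
  rcases h with rfl | rfl <;> simp [Prod.lt_iff]

theorem IsGridPath.last_mem {m n : ℕ} {u v : ℕ × ℕ} {p : List (ℕ × ℕ)}
    (h : IsGridPath m n u v p) : v ∈ p :=
  List.mem_of_getLast? h.2.1

theorem IsGridPath.last_mem_grid {m n : ℕ} {u v : ℕ × ℕ} {p : List (ℕ × ℕ)}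
    (h : IsGridPath m n u v p) : v ∈ gridVertices m n :=
  h.2.2.2.1 _ h.last_mem

theorem IsGridPath.le_last {m n : ℕ} {u v : ℕ × ℕ} {p : List (ℕ × ℕ)}
    (h : IsGridPath m n u v p) {a : ℕ × ℕ} (ha : a ∈ p) : a ≤ v := by
  have hp : p.Pairwise (· < ·) :=
    List.isChain_iff_pairwise.1 (h.2.2.2.2.imp fun _ _ h => h.lt)
  obtain ⟨q, rfl⟩ := List.getLast?_eq_some_iff.1 h.2.1
  rw [List.pairwise_append] at hp
  rcases List.mem_append.1 ha with h1 | h1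
  · exact (hp.2.2 a h1 v (by simp)).le
  · simp at h1
    exact h1.le

theorem IsGridPath.concat {m n : ℕ} {u w v : ℕ × ℕ} {q : List (ℕ × ℕ)}
    (h : IsGridPath m n u w q) (he : GridEdge w v) (hv : v ∈ gridVertices m n) :
    IsGridPath m n u v (q ++ [v]) := by
  refine ⟨?_, by simp, ?_, ?_, ?_⟩
  · rw [List.head?_append, h.1]; rfl
  · rw [List.nodup_append]
    refine ⟨h.2.2.1, by simp, ?_⟩
    intro a ha b hb hab
    simp at hb
    subst hb hab
    exact absurd (h.le_last ha) he.lt.not_ge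
  · intro a ha
    rcases List.mem_append.1 ha with h1 | h1
    · exact h.2.2.2.1 a h1
    · simp at h1
      exact h1 ▸ hv
  · rw [List.isChain_append]
    refine ⟨h.2.2.2.2, by simp, ?_⟩
    intro a ha b hb
    rw [h.2.1] at ha
    simp at ha hb
    subst ha hb
    exact he

theorem IsGridPath.of_concat {m n : ℕ} {u w v : ℕ × ℕ} {q : List (ℕ × ℕ)}
    (h : IsGridPath m n u v (q ++ [w] ++ [v])) :
    IsGridPath m n u w (q ++ [w]) ∧ GridEdge w v := by
  obtain ⟨h1, -, h3, h4, h5⟩ := h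
  rw [List.isChain_append] at h5
  refine ⟨⟨?_, by simp, (List.nodup_append.1 h3).1, fun a ha => h4 a (by simp at ha ⊢; tauto),
    h5.1⟩, h5.2.2 w (by simp) v (by simp)⟩
  rw [← h1]
  cases q <;> simp

/-- Grid paths from `(1, l + 1)` to `v`, completed by an empty path to `(0, l + 1)`. -/
def IsExtPath (m n l : ℕ) (v : ℕ × ℕ) (p : List (ℕ × ℕ)) : Prop :=
  (v = (0, l + 1) ∧ p = []) ∨ IsGridPath m n (1, l + 1) v p

theorem isExtPath_of_pos {m n l : ℕ} {v : ℕ × ℕ} {p : List (ℕ × ℕ)} (hv : v.1 ≠ 0) :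
    IsExtPath m n l v p ↔ IsGridPath m n (1, l + 1) v p := by
  refine ⟨?_, Or.inr⟩
  rintro (⟨rfl, -⟩ | h)
  · exact absurd rfl hv
  · exact h

theorem isExtPath_row_zero {m n l b : ℕ} {p : List (ℕ × ℕ)} :
    IsExtPath m n l (0, b) p ↔ b = l + 1 ∧ p = [] := by
  refine ⟨?_, ?_⟩
  · rintro (⟨h, rfl⟩ | h)
    · simpa using h
    · have := h.last_mem_grid
      simp [gridVertices] at this
  · rintro ⟨rfl, rfl⟩
    exact Or.inl ⟨rfl, rfl⟩

theorem IsExtPath.le_last {m n l : ℕ} {v a : ℕ × ℕ} {p : List (ℕ × ℕ)}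
    (h : IsExtPath m n l v p) (ha : a ∈ p) : a ≤ v := by
  rcases h with ⟨rfl, rfl⟩ | h
  · simp at ha
  · exact h.le_last ha

/-- The empty path at row `0` makes this uniform: it is what remains of the one-vertex path at the
source. -/
theorem isExtPath_succ {m n l i b : ℕ} (hi : i + 1 ≤ m) (hb : b + 1 ≤ n) {p : List (ℕ × ℕ)} :
    IsExtPath m n l (i + 1, b + 1) p ↔
      ∃ q, p = q ++ [(i + 1, b + 1)] ∧ (IsExtPath m n l (i + 1, b) q ∨
        IsExtPath m n l (i, b + 1) q) := by
  rw [isExtPath_of_pos (by simp)]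
  have hv : (i + 1, b + 1) ∈ gridVertices m n := by simp [gridVertices]; omega
  constructor
  · intro h
    obtain ⟨q, rfl⟩ := List.getLast?_eq_some_iff.1 h.2.1
    refine ⟨q, rfl, ?_⟩
    rcases List.eq_nil_or_concat q with rfl | ⟨q, w, rfl⟩
    · have := h.1
      simp at this
      right
      left
      simp
      omega
    · rw [List.concat_eq_append] at h ⊢
      obtain ⟨h1, h2⟩ := h.of_concat
      obtain ⟨w1, w2⟩ := w
      rcases h2 with h2 | h2
      · simp at h2
        obtain ⟨rfl, rfl⟩ := h2
        exact Or.inr (Or.inr h1)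
      · simp at h2
        obtain ⟨rfl, rfl⟩ := h2
        exact Or.inl (Or.inr h1)
  · rintro ⟨q, rfl, (⟨h, -⟩ | h) | (⟨h, rfl⟩ | h)⟩
    · simp at h
    · exact h.concat (Or.inr rfl) hv
    · simp at h
      obtain ⟨rfl, rfl⟩ := h
      refine ⟨by simp, by simp, by simp, ?_, by simp⟩
      intro a ha
      simp at ha
      exact ha ▸ hv
    · exact h.concat (Or.inl rfl) hv

theorem IsExtPath.ne_of_ne {m n l : ℕ} {v w : ℕ × ℕ} {p q : List (ℕ × ℕ)}
    (hp : IsExtPath m n l v p) (hq : IsExtPath m n l w q) (hvw : v ≠ w) : p ≠ q := by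
  rintro rfl
  rcases hp with ⟨rfl, rfl⟩ | hp <;> rcases hq with ⟨rfl, h⟩ | hq
  · exact hvw rfl
  · simpa using hq.last_mem
  · subst h
    simpa using hp.last_mem
  · have := hp.2.1
    rw [hq.2.1] at this
    simp at this
    exact hvw this.symm

/-! ### Disjoint tuples and the determinant formula. -/

/-- Tuples of pairwise disjoint completed paths to the sinks `T`. -/
def extTuples (m n k : ℕ) (T : Fin k → ℕ × ℕ) : Set (Fin k → List (ℕ × ℕ)) :=
  {P | (∀ s : Fin k, IsExtPath m n s (T s) (P s)) ∧ ∀ s t, s ≠ t → List.Disjoint (P s) (P t)}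

theorem finite_isExtPath (m n l : ℕ) (v : ℕ × ℕ) : {p | IsExtPath m n l v p}.Finite := by
  have h := ((finite_NCPath m n 1 (fun _ => (1, l + 1)) (fun _ => v)).image (fun P => P 0)).union
    (Set.finite_singleton [])
  refine h.subset ?_
  rintro p (⟨-, rfl⟩ | hp)
  · simp
  · refine Or.inl ⟨fun _ => p, ⟨fun _ => hp, fun s t hst => absurd (Subsingleton.elim s t) hst⟩, rfl⟩

theorem finite_extTuples (m n k : ℕ) (T : Fin k → ℕ × ℕ) : (extTuples m n k T).Finite :=
  (Set.Finite.pi' fun s : Fin k => finite_isExtPath m n s (T s)).subset fun _ hP s => hP.1 s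

/-- Extending the path with index `t` by the vertex `v`. -/
def appendAt {k : ℕ} (t : Fin k) (v : ℕ × ℕ) (P : Fin k → List (ℕ × ℕ)) :
    Fin k → List (ℕ × ℕ) :=
  Function.update P t (P t ++ [v])

theorem appendAt_injective {k : ℕ} (t : Fin k) (v : ℕ × ℕ) :
    Function.Injective (appendAt t v) := by
  intro P Q h
  ext1 s
  have hs := congrFun h s
  by_cases hst : s = t
  · subst hst
    simpa [appendAt] using hs
  · simpa [appendAt, hst] using hs

theorem tupleWeight_appendAt {k : ℕ} (x : ℕ → ℕ → ℝ) (t : Fin k) (v : ℕ × ℕ)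
    (P : Fin k → List (ℕ × ℕ)) :
    tupleWeight x (appendAt t v P) = x v.1 v.2 * tupleWeight x P := by
  unfold tupleWeight
  rw [← Finset.mul_prod_erase _ _ (Finset.mem_univ t),
    ← Finset.mul_prod_erase (a := t) _ (fun s => ((P s).map fun v => x v.1 v.2).prod)
      (Finset.mem_univ t)]
  have : ∀ s ∈ Finset.univ.erase t, (((appendAt t v P) s).map fun v => x v.1 v.2).prod =
      ((P s).map fun v => x v.1 v.2).prod := fun s hs => by
    simp [appendAt, Finset.ne_of_mem_erase hs]
  rw [Finset.prod_congr rfl this]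
  simp [appendAt]
  ring

/-- A path stays weakly below its sink in the product order, so by `hmax` no other path can meet `T
t`. That vertex can be removed or appended without affecting disjointness. -/
theorem extTuples_eq_union {m n k i b : ℕ} {T : Fin k → ℕ × ℕ} {t : Fin k}
    (ht : T t = (i + 1, b + 1)) (hi : i + 1 ≤ m) (hb : b + 1 ≤ n)
    (hmax : ∀ s, s ≠ t → ¬ T t ≤ T s) :
    extTuples m n k T =
      appendAt t (i + 1, b + 1) '' extTuples m n k (Function.update T t (i + 1, b)) ∪
      appendAt t (i + 1, b + 1) '' extTuples m n k (Function.update T t (i, b + 1)) := by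
  have key : ∀ v, v = (i + 1, b) ∨ v = (i, b + 1) →
      ∀ P, P ∈ extTuples m n k (Function.update T t v) →
        appendAt t (i + 1, b + 1) P ∈ extTuples m n k T := by
    rintro v hv P ⟨h1, h2⟩
    have hT : ∀ s : Fin k, s ≠ t → IsExtPath m n s (T s) (P s) := fun s hs => by
      simpa [hs] using h1 s
    have hnot : ∀ s, s ≠ t → (i + 1, b + 1) ∉ P s := fun s hs hm =>
      hmax s hs (ht ▸ (hT s hs).le_last hm)
    refine ⟨fun s => ?_, fun s s' hss => ?_⟩
    · by_cases hs : s = t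
      · subst hs
        rw [ht, isExtPath_succ hi hb]
        refine ⟨P s, by simp [appendAt], ?_⟩
        have := h1 s
        rw [Function.update_self] at this
        rcases hv with rfl | rfl
        · exact Or.inl this
        · exact Or.inr this
      · simpa [appendAt, hs] using hT s hs
    · by_cases hs : s = t
      · subst hs
        have hs' := hss.symm
        simp only [appendAt, Function.update_self, Function.update_of_ne hs']
        rw [List.disjoint_append_left]
        exact ⟨h2 _ _ hss, by simpa using hnot s' hs'⟩
      · by_cases hs' : s' = t
        · subst hs'
          simp only [appendAt, Function.update_self, Function.update_of_ne hs]
          rw [List.disjoint_append_right]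
          exact ⟨h2 _ _ hss, by simpa using hnot s hs⟩
        · simpa [appendAt, hs, hs'] using h2 _ _ hss
  apply Set.Subset.antisymm
  · rintro P ⟨h1, h2⟩
    have h := h1 t
    rw [ht, isExtPath_succ hi hb] at h
    obtain ⟨q, hq, h⟩ := h
    have hP : appendAt t (i + 1, b + 1) (Function.update P t q) = P := by
      ext1 s
      by_cases hs : s = t
      · subst hs; simp [appendAt, hq]
      · simp [appendAt, hs]
    have hmem : ∀ v, IsExtPath m n t v q →
        Function.update P t q ∈ extTuples m n k (Function.update T t v) := by
      intro v hv
      have hsub : ∀ s, Function.update P t q s ⊆ P s := by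
        intro s
        by_cases hs : s = t
        · subst hs; simp [hq]
        · simp [hs]
      refine ⟨fun s => ?_, fun s s' hss a ha ha' => h2 s s' hss (hsub s ha) (hsub s' ha')⟩
      by_cases hs : s = t
      · subst hs; simpa using hv
      · simpa [hs] using h1 s
    rcases h with h | h
    · exact Or.inl ⟨_, hmem _ h, hP⟩
    · exact Or.inr ⟨_, hmem _ h, hP⟩
  · rintro _ (⟨P, hP, rfl⟩ | ⟨P, hP, rfl⟩)
    · exact key _ (Or.inl rfl) P hP
    · exact key _ (Or.inr rfl) P hP

theorem finsum_extTuples_succ {m n k i b : ℕ} (x : ℕ → ℕ → ℝ) {T : Fin k → ℕ × ℕ} {t : Fin k}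
    (ht : T t = (i + 1, b + 1)) (hi : i + 1 ≤ m) (hb : b + 1 ≤ n)
    (hmax : ∀ s, s ≠ t → ¬ T t ≤ T s) :
    ∑ᶠ P ∈ extTuples m n k T, tupleWeight x P = x (i + 1) (b + 1) *
      (∑ᶠ P ∈ extTuples m n k (Function.update T t (i + 1, b)), tupleWeight x P +
        ∑ᶠ P ∈ extTuples m n k (Function.update T t (i, b + 1)), tupleWeight x P) := by
  rw [extTuples_eq_union ht hi hb hmax, finsum_mem_union, finsum_mem_image, finsum_mem_image,
    mul_add, mul_finsum_mem, mul_finsum_mem]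
  · simp only [tupleWeight_appendAt]
  · exact (appendAt_injective _ _).injOn
  · exact (appendAt_injective _ _).injOn
  · rw [Set.disjoint_left]
    rintro _ ⟨P, hP, rfl⟩ ⟨Q, hQ, h⟩
    have hPQ := appendAt_injective _ _ h
    subst hPQ
    have h1 := hP.1 t
    have h2 := hQ.1 t
    rw [Function.update_self] at h1 h2
    exact h1.ne_of_ne h2 (by simp) rfl
  · exact (finite_extTuples _ _ _ _).image _
  · exact (finite_extTuples _ _ _ _).image _

/-- The path matrix with columns at the sinks `T`. -/
def sinkMatrix (x : ℕ → ℕ → ℝ) {k : ℕ} (T : Fin k → ℕ × ℕ) : Matrix (Fin k) (Fin k) ℝ :=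
  Matrix.of fun a l => pathSum x a (T l).1 (T l).2

theorem updateCol_sinkMatrix (x : ℕ → ℕ → ℝ) {k : ℕ} (T : Fin k → ℕ × ℕ) (t : Fin k) (v : ℕ × ℕ) :
    (sinkMatrix x T).updateCol t (fun a => pathSum x a v.1 v.2) =
      sinkMatrix x (Function.update T t v) := by
  ext a l
  by_cases h : l = t
  · subst h; simp [sinkMatrix]
  · simp [sinkMatrix, h]

theorem det_sinkMatrix_succ (x : ℕ → ℕ → ℝ) {k i b : ℕ} {T : Fin k → ℕ × ℕ} {t : Fin k}
    (ht : T t = (i + 1, b + 1)) :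
    (sinkMatrix x T).det = x (i + 1) (b + 1) *
      ((sinkMatrix x (Function.update T t (i + 1, b))).det +
        (sinkMatrix x (Function.update T t (i, b + 1))).det) := by
  rw [← updateCol_sinkMatrix x T, ← updateCol_sinkMatrix x T, ← Matrix.det_updateCol_add,
    ← Matrix.det_updateCol_smul]
  congr 1
  ext a l
  by_cases h : l = t
  · subst h; simp [sinkMatrix, ht, pathSum, mul_add]
  · simp [h]

theorem extTuples_eq_empty_of_eq {m n k : ℕ} {T : Fin k → ℕ × ℕ} {s t : Fin k} (hst : s ≠ t)
    (h : T s = T t) : extTuples m n k T = ∅ := by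
  rw [Set.eq_empty_iff_forall_notMem]
  rintro P ⟨h1, h2⟩
  have hs := h1 s
  have ht := h1 t
  rw [h] at hs
  rcases hv : T t with ⟨r, b⟩
  rw [hv] at hs ht
  rcases r with _ | r
  · rw [isExtPath_row_zero] at hs ht
    exact hst (Fin.ext (by omega))
  · rw [isExtPath_of_pos (by simp)] at hs ht
    exact h2 s t hst hs.last_mem ht.last_mem

theorem finsum_extTuples_row_zero {m n k : ℕ} (x : ℕ → ℕ → ℝ) {T : Fin k → ℕ × ℕ}
    (hinj : Function.Injective T) (hmono : ∀ s t, s < t → (T s).2 ≤ (T t).2)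
    (h0 : ∀ s, (T s).1 = 0) :
    ∑ᶠ P ∈ extTuples m n k T, tupleWeight x P = (sinkMatrix x T).det := by
  have hT : ∀ s, T s = (0, (T s).2) := fun s => Prod.ext (h0 s) rfl
  by_cases hall : ∀ s : Fin k, (T s).2 = s + 1
  · have h1 : extTuples m n k T = {fun _ => []} := by
      ext P
      constructor
      · intro hP
        ext1 s
        have := hP.1 s
        rw [hT, isExtPath_row_zero] at this
        exact this.2
      · rintro rfl
        refine ⟨fun s => ?_, fun _ _ _ => by simp⟩
        rw [hT, isExtPath_row_zero]
        exact ⟨hall s, rfl⟩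
    have h2 : sinkMatrix x T = 1 := by
      ext a l
      simp [sinkMatrix, h0, hall, pathSum, Matrix.one_apply, Fin.ext_iff, eq_comm]
    rw [h1, h2, finsum_mem_singleton]
    simp [tupleWeight]
  · have h1 : extTuples m n k T = ∅ := by
      rw [Set.eq_empty_iff_forall_notMem]
      intro P hP
      refine hall fun s => ?_
      have := hP.1 s
      rw [hT, isExtPath_row_zero] at this
      exact this.1
    rw [h1, finsum_mem_empty]
    by_cases hr : ∀ s : Fin k, 1 ≤ (T s).2 ∧ (T s).2 ≤ k
    -- Distinct, weakly increasing columns in `1, …, k` must be exactly `1, …, k`, contrary to the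
    -- case assumption.
    · exfalso
      let f : Fin k → Fin k := fun s => ⟨(T s).2 - 1, by have := hr s; omega⟩
      have hf : StrictMono f := by
        intro s t hst
        have h3 := hmono s t hst
        have h4 : (T s).2 ≠ (T t).2 := fun h =>
          hst.ne (hinj (by rw [hT s, hT t, h]))
        have := hr s
        simp only [f, Fin.lt_def]
        omega
      have hfid : f = id := funext fun s =>
        le_antisymm hf.apply_le hf.le_apply
      refine hall fun s => ?_
      have h5 := congrArg Fin.val (congrFun hfid s)
      have := hr s
      simp only [f, id] at h5
      omega
    · push Not at hr
      obtain ⟨s, hs⟩ := hr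
      refine (Matrix.det_eq_zero_of_column_eq_zero s fun a => ?_).symm
      have := a.2
      simp [sinkMatrix, h0, pathSum]
      omega

/-- The Lindström–Gessel–Viennot formula for the grid, for sinks arranged weakly from
bottom left to top right. -/
theorem finsum_extTuples_eq_det {m n k : ℕ} (x : ℕ → ℕ → ℝ) (T : Fin k → ℕ × ℕ)
    (hmono : ∀ s t, s < t → (T t).1 ≤ (T s).1 ∧ (T s).2 ≤ (T t).2)
    (hm : ∀ s, (T s).1 ≤ m) (hn : ∀ s, (T s).2 ≤ n) :
    ∑ᶠ P ∈ extTuples m n k T, tupleWeight x P = (sinkMatrix x T).det := by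
  induction hN : ∑ s, ((T s).1 + (T s).2) using Nat.strong_induction_on generalizing T with
  | _ N ih =>
  by_cases hinj : Function.Injective T
  -- Moving a sink may make it coincide with another: then disjoint tuples do not exist and the
  -- determinant has equal columns.
  swap
  · simp only [Function.Injective, not_forall] at hinj
    obtain ⟨s, t, hst, hne⟩ := hinj
    rw [extTuples_eq_empty_of_eq hne hst, finsum_mem_empty]
    exact (Matrix.det_zero_of_column_eq hne fun a => by simp [sinkMatrix, hst]).symm
  by_cases h0 : ∀ s, (T s).1 = 0
  · exact finsum_extTuples_row_zero x hinj (fun s t h => (hmono s t h).2) h0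
  push Not at h0
  obtain ⟨s0, hs0⟩ := h0
  -- The rightmost sink of the lowest occupied row is below no other sink, and moving it left or up
  -- preserves the weak arrangement.
  obtain ⟨t, -, ht⟩ := Finset.exists_max_image Finset.univ (fun s => toLex (T s))
    ⟨s0, Finset.mem_univ _⟩
  have hlex : ∀ s, s ≠ t → (T s).1 < (T t).1 ∨ (T s).1 = (T t).1 ∧ (T s).2 < (T t).2 := by
    intro s hs
    have h1 : toLex (T s) < toLex (T t) :=
      lt_of_le_of_ne (ht s (Finset.mem_univ _)) fun h => hs (hinj (toLex.injective h))
    simpa [Prod.Lex.lt_iff] using h1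
  have hpos : (T t).1 ≠ 0 := by
    by_cases h : s0 = t
    · exact h ▸ hs0
    · have := hlex s0 h
      omega
  rcases hTt : T t with ⟨i, b⟩
  obtain ⟨i, rfl⟩ : ∃ c, i = c + 1 := ⟨i - 1, by rw [hTt] at hpos; simp at hpos; omega⟩
  have hmt := hm t
  have hnt := hn t
  simp only [hTt] at hlex hmt hnt
  rcases b with _ | b
  · have h1 : extTuples m n k T = ∅ := by
      rw [Set.eq_empty_iff_forall_notMem]
      intro P hP
      have := hP.1 t
      rw [hTt, isExtPath_of_pos (by simp)] at this
      have := this.last_mem_grid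
      simp [gridVertices] at this
    rw [h1, finsum_mem_empty]
    exact (Matrix.det_eq_zero_of_column_eq_zero t fun a => by
      simp [sinkMatrix, hTt, pathSum]).symm
  have hstep : ∀ v : ℕ × ℕ, v = (i + 1, b) ∨ v = (i, b + 1) →
      ∑ᶠ P ∈ extTuples m n k (Function.update T t v), tupleWeight x P =
        (sinkMatrix x (Function.update T t v)).det := by
    intro v hv
    refine ih _ ?_ _ ?_ ?_ ?_ rfl
    · rw [← hN]
      refine Finset.sum_lt_sum (fun s _ => ?_) ⟨t, Finset.mem_univ _, ?_⟩
      · by_cases hs : s = t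
        · subst hs
          rw [Function.update_self, hTt]
          rcases hv with rfl | rfl <;> simp
        · rw [Function.update_of_ne hs]
      · rw [Function.update_self, hTt]
        rcases hv with rfl | rfl <;> simp
    · intro s s' hss
      have h1 := hmono s s' hss
      by_cases hs : s = t
      · subst hs
        have h2 := hlex s' hss.ne'
        rw [Function.update_self, Function.update_of_ne hss.ne']
        rw [hTt] at h1
        rcases hv with rfl | rfl <;> simp at h1 ⊢ <;> omega
      · by_cases hs' : s' = t
        · subst hs'
          have h2 := hlex s hs
          rw [Function.update_self, Function.update_of_ne hs]
          rw [hTt] at h1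
          rcases hv with rfl | rfl <;> simp at h1 ⊢ <;> omega
        · rw [Function.update_of_ne hs, Function.update_of_ne hs']
          exact h1
    · intro s
      by_cases hs : s = t
      · subst hs
        rw [Function.update_self]
        rcases hv with rfl | rfl <;> simp <;> omega
      · rw [Function.update_of_ne hs]
        exact hm s
    · intro s
      by_cases hs : s = t
      · subst hs
        rw [Function.update_self]
        rcases hv with rfl | rfl <;> simp <;> omega
      · rw [Function.update_of_ne hs]
        exact hn s
  rw [finsum_extTuples_succ x hTt hmt hnt, hstep _ (Or.inl rfl), hstep _ (Or.inr rfl),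
    ← det_sinkMatrix_succ x hTt]
  intro s hs hle
  have h2 := hlex s hs
  rw [hTt, Prod.le_def] at hle
  simp at hle
  omega

/-! ### Passage to `ybar`, `ytilde` and birational RSK. -/

theorem rskPath_eq_extTuples {m n i j k : ℕ} (hk : k ≤ i) :
    RSKPath m n i j k = extTuples m n k (fun s => (i, j - k + (s + 1))) := by
  ext P
  refine and_congr_left fun _ => forall_congr' fun s => ?_
  rw [isExtPath_of_pos]
  have := s.2
  simp
  omega

theorem ybar_eq_pathMinor {m n : ℕ} {x : ℕ → ℕ → ℝ} (hx : ∀ r s, 0 < x r s) {i j k : ℕ}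
    (hki : k ≤ i) (hkj : k ≤ j) (hi : i ≤ m) (hj : j ≤ n) :
    ybar m n x i j k = pathMinor x i (j - k + 1) k := by
  have h := finsum_extTuples_eq_det (m := m) (n := n) x
    (fun s : Fin k => (i, j - k + ((s : ℕ) + 1)))
    (fun s t hst => ⟨le_rfl, by simp only [Fin.lt_def] at hst ⊢; omega⟩) (fun _ => hi)
    (fun s => by have := s.2; simp only; omega)
  have hdet : (sinkMatrix x (fun s : Fin k => (i, j - k + ((s : ℕ) + 1)))).det =
      pathMinor x i (j - k + 1) k := by
    unfold sinkMatrix pathMinor colMinor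
    congr 1
    ext a l
    simp only [Matrix.of_apply]
    congr 1
    ring
  rw [hdet, ← rskPath_eq_extTuples hki] at h
  -- An empty family would give a zero minor, so the convention for empty sums never applies here.
  have hne : RSKPath m n i j k ≠ ∅ := by
    intro h0
    rw [h0, finsum_mem_empty] at h
    exact (pathMinor_pos hx hki (j - k)).ne h
  rw [ybar, if_neg hne, ← h]
  exact (finsum_mem_eq_finite_toFinset_sum _ (finite_NCPath _ _ _ _ _)).symm

/-- Replacing the entries outside of the grid by `1`. -/
noncomputable def extendOne (m n : ℕ) (x : ℕ → ℕ → ℝ) (r s : ℕ) : ℝ :=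
  if (r, s) ∈ gridVertices m n then x r s else 1

theorem ybar_extendOne (m n : ℕ) (x : ℕ → ℕ → ℝ) :
    ybar m n (extendOne m n x) = ybar m n x := by
  ext i j k
  unfold ybar
  congr 1
  refine Finset.sum_congr rfl fun P hP => Finset.prod_congr rfl fun s _ => ?_
  rw [Set.Finite.mem_toFinset] at hP
  congr 1
  exact List.map_congr_left fun v hv => if_pos ((hP.1 s).2.2.2.1 v hv)

theorem rect_extendOne (m n : ℕ) (x : ℕ → ℕ → ℝ) :
    rect m n (extendOne m n x) = rect m n x := by
  ext i j
  unfold rect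
  split_ifs with h
  · refine Finset.prod_congr rfl fun r hr => Finset.prod_congr rfl fun s hs => if_pos ?_
    simp [gridVertices] at h hr hs ⊢
    omega
  · rfl

theorem rect_eq_rectProd {m n i j : ℕ} (x : ℕ → ℕ → ℝ) (hi : i ≤ m) (hj : j ≤ n) :
    rect m n x i j = rectProd x i j := by
  unfold rect
  split_ifs with h
  · rfl
  · have : i = 0 ∨ j = 0 := by
      simp [gridVertices] at h
      omega
    rcases this with rfl | rfl <;> simp [rectProd]

theorem IsIndex.bounds {m n i j k : ℕ} (h : IsIndex m n i j k) :
    k ≤ i ∧ k ≤ j ∧ i ≤ m ∧ j ≤ n := by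
  obtain ⟨h1, a, ha, b, hb, h2⟩ := h
  simp [gridVertices] at h2
  omega

theorem IsIndex.of_le {m n i j k i' j' k' : ℕ} (h : IsIndex m n i j k) (hi : i' ≤ i) (hj : j' ≤ j)
    (hk : k' ≤ min i' j') : IsIndex m n i' j' k' := by
  obtain ⟨h1, a, ha, b, hb, h2⟩ := h
  simp [gridVertices] at h2
  refine ⟨hk, if i' = 0 then 1 else 0, by split_ifs <;> simp, if j' = 0 then 1 else 0,
    by split_ifs <;> simp, ?_⟩
  simp [gridVertices]
  split_ifs <;> omega

theorem ybar_zero {m n i j : ℕ} {x : ℕ → ℕ → ℝ} (hx : ∀ r s, 0 < x r s)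
    (h : IsIndex m n i j 0) : ybar m n x i j 0 = 1 := by
  obtain ⟨h1, h2, h3, h4⟩ := h.bounds
  rw [ybar_eq_pathMinor hx h1 h2 h3 h4]
  exact colMinor_zero _

theorem ybar_pos {m n i j k : ℕ} {x : ℕ → ℕ → ℝ} (hx : ∀ r s, 0 < x r s)
    (h : IsIndex m n i j k) : 0 < ybar m n x i j k := by
  obtain ⟨h1, h2, h3, h4⟩ := h.bounds
  rw [ybar_eq_pathMinor hx h1 h2 h3 h4]
  exact pathMinor_pos hx h1 _

theorem rect_pos {m n : ℕ} {x : ℕ → ℕ → ℝ} (hx : ∀ r s, 0 < x r s) (i j : ℕ) :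
    0 < rect m n x i j := by
  unfold rect
  split_ifs
  · exact rectProd_pos hx i j
  · exact one_pos

theorem ytilde_pos {m n i j k : ℕ} {x : ℕ → ℕ → ℝ} (hx : ∀ r s, 0 < x r s)
    (h : IsIndex m n i j k) : 0 < ytilde m n x i j k :=
  div_pos (ybar_pos hx h) (rect_pos hx i j)

theorem ybar_min {m n i j : ℕ} {x : ℕ → ℕ → ℝ} (hx : ∀ r s, 0 < x r s)
    (h : IsIndex m n i j (min i j)) : ybar m n x i j (min i j) = rect m n x i j := by
  obtain ⟨h1, h2, h3, h4⟩ := h.bounds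
  rw [ybar_eq_pathMinor hx h1 h2 h3 h4, rect_eq_rectProd x h3 h4]
  rcases le_total i j with hij | hij
  · rw [min_eq_left hij, pathMinor_self hx, Nat.sub_add_cancel hij]
  · rw [min_eq_right hij, Nat.sub_self, pathMinor_one]

theorem boundedOctahedron_ytilde {m n : ℕ} {x : ℕ → ℕ → ℝ} (hx : ∀ r s, 0 < x r s) :
    BoundedOctahedron m n x (ytilde m n x) := by
  refine ⟨fun i j h => ?_, fun i j h => ?_, fun i j k h hk1 hk2 => ?_⟩
  · rw [ytilde, ybar_zero hx h]
  · rw [ytilde, ybar_min hx h, div_self (rect_pos hx i j).ne']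
  · obtain ⟨h1, h2, h3, h4⟩ := h.bounds
    obtain ⟨i, rfl⟩ : ∃ c, i = c + 1 := ⟨i - 1, by omega⟩
    obtain ⟨j, rfl⟩ : ∃ c, j = c + 1 := ⟨j - 1, by omega⟩
    obtain ⟨k, rfl⟩ : ∃ c, k = c + 1 := ⟨k - 1, by omega⟩
    obtain ⟨q, rfl⟩ : ∃ q, j = q + 1 + k := ⟨j - (k + 1), by omega⟩
    simp only [Nat.add_sub_cancel]
    unfold ytilde
    rw [ybar_eq_pathMinor hx h1 h2 h3 h4,
      ybar_eq_pathMinor hx (i := i) (j := q + 1 + k) (k := k) (by omega) (by omega) (by omega)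
        (by omega),
      ybar_eq_pathMinor hx (i := i) (j := q + 1 + k + 1) (k := k + 1) (by omega) (by omega)
        (by omega) (by omega),
      ybar_eq_pathMinor hx (i := i + 1) (j := q + 1 + k) (k := k) (by omega) (by omega) (by omega)
        (by omega),
      ybar_eq_pathMinor hx (i := i) (j := q + 1 + k + 1) (k := k) (by omega) (by omega) (by omega)
        (by omega),
      ybar_eq_pathMinor hx (i := i + 1) (j := q + 1 + k) (k := k + 1) (by omega) (by omega)
        (by omega) (by omega),
      rect_eq_rectProd x (i := i + 1) (j := q + 1 + k + 1) (by omega) (by omega),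
      rect_eq_rectProd x (i := i) (j := q + 1 + k) (by omega) (by omega),
      rect_eq_rectProd x (i := i) (j := q + 1 + k + 1) (by omega) (by omega),
      rect_eq_rectProd x (i := i + 1) (j := q + 1 + k) (by omega) (by omega),
      show q + 1 + k + 1 - (k + 1) + 1 = q + 1 + 1 by omega,
      show q + 1 + k - k + 1 = q + 1 + 1 by omega,
      show q + 1 + k + 1 - k + 1 = q + 1 + 2 by omega,
      show q + 1 + k - (k + 1) + 1 = q + 1 by omega]
    have hO := pathMinor_octahedron x i (q + 1) k
    have hR := rectProd_succ_succ x i (q + 1 + k)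
    rw [show q + 1 + 1 + k = q + 1 + k + 1 by ring] at hO
    have p1 := (rectProd_pos hx (i + 1) (q + 1 + k + 1)).ne'
    have p2 := (rectProd_pos hx i (q + 1 + k)).ne'
    have p3 := (rectProd_pos hx i (q + 1 + k + 1)).ne'
    have p4 := (rectProd_pos hx (i + 1) (q + 1 + k)).ne'
    have p5 := (hx (i + 1) (q + 1 + k + 1)).ne'
    rw [div_mul_div_comm, div_mul_div_comm, div_mul_div_comm, hO, hR]
    field_simp

/-- The other five entries of the recurrence have smaller `i + j`, and the factor of `w i j k` is a
positive entry of `ytilde` by induction, so it cancels. -/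
theorem BoundedOctahedron.eq_ytilde {m n : ℕ} {x : ℕ → ℕ → ℝ} (hx : ∀ r s, 0 < x r s)
    {w : ℕ → ℕ → ℕ → ℝ} (hw : BoundedOctahedron m n x w) {i j k : ℕ} (h : IsIndex m n i j k) :
    w i j k = ytilde m n x i j k := by
  obtain ⟨y0, ymin, yrec⟩ := boundedOctahedron_ytilde (m := m) (n := n) hx
  obtain ⟨w0, wmin, wrec⟩ := hw
  induction hN : i + j using Nat.strong_induction_on generalizing i j k with
  | _ N ih =>
  obtain ⟨h1, h2, h3, h4⟩ := h.bounds
  rcases Nat.eq_zero_or_pos k with rfl | hk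
  · rw [w0 i j h, y0 i j h]
  rcases eq_or_ne k (min i j) with rfl | hk'
  · rw [wmin i j h, ymin i j h]
  have hW := wrec i j k h hk (by omega)
  have hY := yrec i j k h hk (by omega)
  have i1 : IsIndex m n (i - 1) (j - 1) (k - 1) := h.of_le (by omega) (by omega) (by omega)
  have i2 : IsIndex m n (i - 1) j k := h.of_le (by omega) (by omega) (by omega)
  have i3 : IsIndex m n i (j - 1) (k - 1) := h.of_le (by omega) (by omega) (by omega)
  have i4 : IsIndex m n (i - 1) j (k - 1) := h.of_le (by omega) (by omega) (by omega)
  have i5 : IsIndex m n i (j - 1) k := h.of_le (by omega) (by omega) (by omega)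
  rw [ih _ (by omega) i1 rfl, ih _ (by omega) i2 rfl, ih _ (by omega) i3 rfl,
    ih _ (by omega) i4 rfl, ih _ (by omega) i5 rfl, ← hY] at hW
  exact mul_right_cancel₀ (ytilde_pos hx i1).ne' hW

theorem prod_birationalRSK {m n : ℕ} {x : ℕ → ℕ → ℝ} (hx : ∀ r s, 0 < x r s) {i j k : ℕ}
    (h : IsIndex m n i j k) :
    ∏ l ∈ Finset.Icc 1 k, birationalRSK m n x i j l = ybar m n x i j k := by
  induction k with
  | zero => simp [ybar_zero hx h]
  | succ k ih =>
    have hk : IsIndex m n i j k := h.of_le le_rfl le_rfl (by have := h.1; omega)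
    rw [Finset.prod_Icc_succ_top (by omega), ih hk, birationalRSK,
      if_neg (by have := h.1; omega), Nat.add_sub_cancel]
    exact mul_div_cancel₀ _ (ybar_pos hx hk).ne'

theorem BoundedOctahedron.congr {m n : ℕ} {x : ℕ → ℕ → ℝ} {w w' : ℕ → ℕ → ℕ → ℝ}
    (hw : BoundedOctahedron m n x w) (h : ∀ i j k, IsIndex m n i j k → w' i j k = w i j k) :
    BoundedOctahedron m n x w' := by
  obtain ⟨w0, wmin, wrec⟩ := hw
  refine ⟨fun i j hi => ?_, fun i j hi => ?_, fun i j k hi hk1 hk2 => ?_⟩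
  · rw [h _ _ _ hi, w0 i j hi]
  · rw [h _ _ _ hi, wmin i j hi]
  · rw [h _ _ _ hi, h (i - 1) (j - 1) (k - 1) (hi.of_le (by omega) (by omega) (by omega)),
      h (i - 1) j k (hi.of_le (by omega) (by omega) (by omega)),
      h i (j - 1) (k - 1) (hi.of_le (by omega) (by omega) (by omega)),
      h (i - 1) j (k - 1) (hi.of_le (by omega) (by omega) (by omega)),
      h i (j - 1) k (hi.of_le (by omega) (by omega) (by omega))]
    exact wrec i j k hi hk1 hk2

theorem theorem5p1 (m n : ℕ) (x : ℕ → ℕ → ℝ)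
    (hx : ∀ r s, 1 ≤ r → r ≤ m → 1 ≤ s → s ≤ n → 0 < x r s) :
    BoundedOctahedron m n x (ytilde m n x) ∧
    (∀ w : ℕ → ℕ → ℕ → ℝ, BoundedOctahedron m n x w →
      ∀ i j k, IsIndex m n i j k → w i j k = ytilde m n x i j k) ∧
    BoundedOctahedron m n x (fun i j k =>
      (∏ l ∈ Finset.Icc 1 k, birationalRSK m n x i j l) / rect m n x i j) := by
  -- The lemmas assume positivity everywhere; since no quantity involved sees entries outside the
  -- grid, these may be set to `1`.
  have hpos : ∀ r s, 0 < extendOne m n x r s := by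
    intro r s
    unfold extendOne
    split_ifs with h
    · simp [gridVertices] at h
      exact hx r s (by omega) (by omega) (by omega) (by omega)
    · exact one_pos
  have hyt : ytilde m n (extendOne m n x) = ytilde m n x := by
    unfold ytilde
    rw [ybar_extendOne, rect_extendOne]
  have hB : BoundedOctahedron m n (extendOne m n x) = BoundedOctahedron m n x := by
    unfold BoundedOctahedron
    rw [rect_extendOne]
  have hR : birationalRSK m n (extendOne m n x) = birationalRSK m n x := by
    unfold birationalRSK
    rw [ybar_extendOne]
  have hA := boundedOctahedron_ytilde (m := m) (n := n) hpos
  refine ⟨?_, fun w hw i j k h => ?_, ?_⟩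
  · rwa [hyt, hB] at hA
  · rw [← hB] at hw
    rw [hw.eq_ytilde hpos h, hyt]
  · rw [← hB, ← hR, ← rect_extendOne]
    refine hA.congr fun i j k h => ?_
    rw [prod_birationalRSK hpos h, ytilde]
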